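/- Let $(R,\mathfrak m,k)$ be a commutative noetherian local ring of depth $t$. For an integer $i\ge 0$ let $\mu_i(R)=\dim_k\operatorname{Ext}^i_R(k,R)$ be the $i$-th Bass number of $R$, and let $r(R)=\mu_t(R)$ be the type of $R$. For a projective presentation $P_1\xrightarrow{\partial}P_0\to M\to 0$ of a finitely generated $R$-module $M$ by finitely generated projective modules, put $\Omega M=\operatorname{Im}\partial$ and $\operatorname{Tr}M=\operatorname{Coker}(\operatorname{Hom}_R(\partial,R))$; both are determined by $M$ up to projective summands. Put $\Omega^0M=M$ and $\Omega^nM=\Omega(\Omega^{n-1}M)$ for $n>0$. Then, for every choice of the presentations used to form $\operatorname{Tr}\Omega^t k$, the module $\operatorname{Ext}^i_R(\operatorname{Tr}\Omega^t k,R)$ is a $k$-vector space (that is, it is annihilated by $\mathfrak m$) for all integers $i>0$, and the following hold. 1. $\operatorname{Ext}^i_R(\operatorname{Tr}\Omega^t k,R)=0$ for all integers $1\le i\le t+1$. 2. $\dim_k\operatorname{Ext}^{t+2}_R(\operatorname{Tr}\Omega^t k,R)=r(R)^2-1$. 3. $\dim_k\operatorname{Ext}^i_R(\operatorname{Tr}\Omega^t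 k,R)=r(R)\,\mu_{i-2}(R)$ for all integers $i\ge t+3$. -/

import Mathlib

universe u

open CategoryTheory CategoryTheory.Abelian IsLocalRing

namespace LocalSyzygy

noncomputable section

/-- A projective presentation `P₁ → P₀ → M → 0` of an `R`-module by finitely generated projective
modules. -/
structure ProjPresentation (R : Type u) [CommRing R] (M : ModuleCat.{u} R) where
  P₁ : ModuleCat.{u} R
  P₀ : ModuleCat.{u} R
  finite₁ : Module.Finite R P₁
  finite₀ : Module.Finite R P₀
  projective₁ : Module.Projective R P₁
  projective₀ : Module.Projective R P₀
  /-- the differential `P₁ → P₀` -/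
  d : P₁ →ₗ[R] P₀
  /-- the augmentation `P₀ → M` -/
  aug : P₀ →ₗ[R] M
  exact : Function.Exact d aug
  surjective : Function.Surjective aug

/-- `N` is a first syzygy of `M`: it is isomorphic to the image of the differential of some
projective presentation of `M`. -/
def IsSyzygy (R : Type u) [CommRing R] (M N : ModuleCat.{u} R) : Prop :=
  ∃ P : ProjPresentation R M, Nonempty (N ≃ₗ[R] LinearMap.range P.d)

/-- `N` is an `n`-th syzygy of `M`, with arbitrary choices of presentations at every step
(a zeroth syzygy of `M` is `M` itself). -/
def IsNthSyzygy (R : Type u) [CommRing R] : ℕ → ModuleCat.{u} R → ModuleCat.{u} R → Prop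
  | 0, M, N => Nonempty (N ≃ₗ[R] M)
  | n + 1, M, N => ∃ L : ModuleCat.{u} R, IsNthSyzygy R n M L ∧ IsSyzygy R L N

/-- `N` is an Auslander transpose of `M`: it is isomorphic to the cokernel of the dual
`P₀* → P₁*` of the differential of some projective presentation of `M`. -/
def IsTranspose (R : Type u) [CommRing R] (M N : ModuleCat.{u} R) : Prop :=
  ∃ P : ProjPresentation R M,
    Nonempty (N ≃ₗ[R] (Module.Dual R P.P₁ ⧸ LinearMap.range P.d.dualMap))

/-- The depth of a local ring: the supremum of the lengths of regular sequences in the maximal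
ideal. -/
def depth (R : Type u) [CommRing R] [IsLocalRing R] : ℕ∞ :=
  ⨆ rs : {rs : List R // (∀ r ∈ rs, r ∈ maximalIdeal R) ∧ RingTheory.Sequence.IsRegular R rs},
    (rs.1.length : ℕ∞)

/-- An `R`-module is a `k`-vector space, `k` the residue field of `R`, if the maximal ideal
annihilates it, so that the action of `R` factors through `k`. -/
def IsResidueSpace (R : Type u) [CommRing R] [IsLocalRing R] (X : Type u) [AddCommGroup X]
    [Module R X] : Prop :=
  Module.IsTorsionBySet R X (maximalIdeal R : Set R)

/-- The `k`-vector space structure on a module annihilated by the maximal ideal, in which the class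
of `r` acts as `r`. -/
abbrev IsResidueSpace.module {R : Type u} [CommRing R] [IsLocalRing R] {X : Type u}
    [AddCommGroup X] [Module R X] (h : IsResidueSpace R X) : Module (ResidueField R) X :=
  Module.IsTorsionBySet.module (I := maximalIdeal R) h

/-- The dimension (a cardinal) over the residue field of a module annihilated by the maximal
ideal. -/
def IsResidueSpace.dim {R : Type u} [CommRing R] [IsLocalRing R] {X : Type u}
    [AddCommGroup X] [Module R X] (h : IsResidueSpace R X) : Cardinal.{u} :=
  @Module.rank (ResidueField R) X _ _ h.module

theorem isResidueSpace_ext_residueField (R : Type u) [CommRing R] [IsLocalRing R]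
    (M : ModuleCat.{u} R) (i : ℕ) :
    IsResidueSpace R (Ext (ModuleCat.of R (ResidueField R)) M i) := by
  intro x r
  have h0 : (r : R) • 𝟙 (ModuleCat.of R (ResidueField R)) = 0 := by
    refine ModuleCat.hom_ext (LinearMap.ext fun y => ?_)
    change (r : R) • (y : ResidueField R) = 0
    have hr : algebraMap R (ResidueField R) r = 0 := (residue_eq_zero_iff _).2 r.2
    rw [Algebra.smul_def, hr, zero_mul]
  have h : (r : R) • x = (Ext.mk₀ ((r : R) • 𝟙 (ModuleCat.of R (ResidueField R)))).comp x
      (zero_add i) := by simp [Ext.mk₀_smul]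
  exact h.trans (by simp [h0])

/-- The Bass number `μ_i(R) = dim_k Ext^i_R(k, R)`. (For Noetherian `R` this `Ext` is finitely
generated, so the dimension is finite and passing to a natural number loses nothing.) -/
def bassNumber (R : Type u) [CommRing R] [IsLocalRing R] (i : ℕ) : ℕ :=
  Cardinal.toNat (isResidueSpace_ext_residueField R (ModuleCat.of R R) i).dim

/-- The type of a local ring, `dim_k Ext^{depth R}_R(k, R)`. -/
def ringType (R : Type u) [CommRing R] [IsLocalRing R] : ℕ :=
  bassNumber R (depth R).toNat

end

end LocalSyzygy

/-!
Let `π : P₁ → P₀ → S → 0` present `S = Ω^t k`, let `T = Tr S` and let `I` be the image of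
`P₀* → P₁*`, so that `Ext^{i+1}(T, R) ≅ Ext^i(I, R)` for `i > 0`. The module `I` is the cokernel of
an inclusion `K → W` with `K ≅ k^r`, where `r` is the type of `R`: for `t = 0` it is `S* → P₀*`,
and for `t > 0`, where `S` is a syzygy of `X = Ω^{t-1} k`, it is `Ext¹(X, R) → Tr X`, with
`Ext¹(X, R) ≅ Ext^t(k, R)`. In positive degrees `Ext^i(W, R)` lives only in degree `t`, and the
image of `Ext^t(W, R)` in `Ext^t(K, R) ≅ k^{r²}` is a copy of `k`; removing this line produces the
`r² - 1`.

For `t > 0` one has `Ext^t(W, R) ≅ k`, so it suffices that `Ext^t(W, R) → Ext^t(K, R)` is nonzero.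
This holds since a nonzero map `k → W` has nonzero product with some class of `Ext^t(W, R)`, which
follows by dimension shifting from the case of a projective module.
-/

namespace LocalSyzygy

section Ext

open Limits

variable {R : Type u} [CommRing R]

/-- The map `Ext^n(B, Y) → Ext^n(A, Y)` induced by `f : A → B`. -/
noncomputable abbrev extMap {A B : ModuleCat.{u} R} (f : A ⟶ B) (Y : ModuleCat.{u} R) (n : ℕ) :
    Ext B Y n →ₗ[R] Ext A Y n :=
  (Ext.mk₀ f).precompOfLinear R Y (zero_add n)

/-- The isomorphism `Ext^n(A, Y) ≃ Ext^n(B, Y)` induced by an isomorphism `A ≅ B`. -/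
noncomputable def extCongrLeft {A B : ModuleCat.{u} R} (e : A ≅ B) (Y : ModuleCat.{u} R) (n : ℕ) :
    Ext A Y n ≃ₗ[R] Ext B Y n :=
  LinearEquiv.ofLinearMap (extMap e.inv Y n) (extMap e.hom Y n)
    (by ext x; simp [Ext.mk₀_comp_mk₀_assoc])
    (by ext x; simp [Ext.mk₀_comp_mk₀_assoc])

theorem nonempty_ext_pi_equiv (X Y : ModuleCat.{u} R) (r n : ℕ) :
    Nonempty (Ext (ModuleCat.of R (Fin r → X)) Y n ≃ₗ[R] (Fin r → Ext X Y n)) :=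
  let e := Ext.biproductAddEquiv (biproduct.isBilimit fun _ : Fin r => X) Y n
  ⟨(extCongrLeft (ModuleCat.biproductIsoPi fun _ : Fin r => X).symm Y n).trans
    (e.toLinearEquiv fun c x => funext fun i =>
      map_smul (extMap (biproduct.ι _ i) Y n) c x)⟩

theorem subsingleton_ext_of_projective (Q Y : ModuleCat.{u} R) [Module.Projective R Q]
    (n : ℕ) : Subsingleton (Ext Q Y (n + 1)) :=
  have : Projective Q := (IsProjective.iff_projective (R := R) Q).1 inferInstance
  Ext.subsingleton_of_projective Q Y n

section ShortExact

variable {S : ShortComplex (ModuleCat.{u} R)} (hS : S.ShortExact) (Y : ModuleCat.{u} R)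
include hS

theorem nonempty_ext_quotient_equiv (n : ℕ) (h₂ : Subsingleton (Ext S.X₂ Y (n + 1))) :
    Nonempty ((Ext S.X₁ Y n ⧸ (extMap S.f Y n).range) ≃ₗ[R] Ext S.X₃ Y (n + 1)) := by
  let δ := hS.extClass.precompOfLinear R Y (add_comm 1 n)
  have hδ : Function.Exact (extMap S.f Y n) δ := fun x =>
    ⟨Ext.contravariant_sequence_exact₁ hS Y x (add_comm 1 n), by
      rintro ⟨y, rfl⟩
      exact hS.extClass_comp_assoc _ (h := add_comm 1 n)⟩
  exact ⟨hδ.linearEquivOfSurjective fun x =>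
    Ext.contravariant_sequence_exact₃ hS Y x (Subsingleton.elim _ _) (add_comm 1 n)⟩

theorem nonempty_ext_equiv_ext_succ (n : ℕ) (h₂ : Subsingleton (Ext S.X₂ Y n))
    (h₂' : Subsingleton (Ext S.X₂ Y (n + 1))) :
    Nonempty (Ext S.X₁ Y n ≃ₗ[R] Ext S.X₃ Y (n + 1)) := by
  obtain ⟨e⟩ := nonempty_ext_quotient_equiv hS Y n h₂'
  have hbot : (extMap S.f Y n).range = ⊥ := LinearMap.range_eq_bot.2 (Subsingleton.elim _ _)
  exact ⟨(Submodule.quotEquivOfEqBot _ hbot).symm.trans e⟩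

theorem nonempty_ext_equiv_ext_succ_of_projective [Module.Projective R S.X₂] {n : ℕ} (hn : 0 < n) :
    Nonempty (Ext S.X₁ Y n ≃ₗ[R] Ext S.X₃ Y (n + 1)) := by
  obtain ⟨n, rfl⟩ := Nat.exists_eq_succ_of_ne_zero hn.ne'
  exact nonempty_ext_equiv_ext_succ hS Y _ (subsingleton_ext_of_projective _ _ _)
    (subsingleton_ext_of_projective _ _ _)

theorem subsingleton_ext_of_injective_extMap {n : ℕ} (h₁ : Subsingleton (Ext S.X₁ Y n))
    (hf : Function.Injective (extMap S.f Y (n + 1))) : Subsingleton (Ext S.X₃ Y (n + 1)) := by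
  refine subsingleton_of_forall_eq 0 fun z => ?_
  have hz : (Ext.mk₀ S.g).comp z (zero_add _) = 0 := hf <| by
    simp [Ext.mk₀_comp_mk₀_assoc]
  obtain ⟨y, rfl⟩ := Ext.contravariant_sequence_exact₃ hS Y z hz (add_comm 1 n)
  rw [Subsingleton.elim y 0, Ext.comp_zero]

end ShortExact

section Dual

open Module

/-- `Hom(A, R) ≃ Ext⁰(A, R)`. -/
noncomputable def dualEquivExtZero (A : ModuleCat.{u} R) :
    Dual R A ≃ₗ[R] Ext A (ModuleCat.of R R) 0 :=
  (ModuleCat.homLinearEquiv (S := R) (N := ModuleCat.of R R)).symm.trans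
    (Ext.linearEquiv₀ (R := R)).symm

theorem extMap_dualEquivExtZero {A B : ModuleCat.{u} R} (f : A ⟶ B) (φ : Dual R B) :
    extMap f (ModuleCat.of R R) 0 (dualEquivExtZero B φ) = dualEquivExtZero A (f.hom.dualMap φ) :=
  Ext.mk₀_comp_mk₀ _ _

theorem map_dualEquivExtZero_range_dualMap {A B : ModuleCat.{u} R} (f : A ⟶ B) :
    (LinearMap.range f.hom.dualMap).map (dualEquivExtZero A : Dual R A →ₗ[R] _) =
      (extMap f (ModuleCat.of R R) 0).range := by
  have : (dualEquivExtZero A : Dual R A →ₗ[R] _) ∘ₗ f.hom.dualMap =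
      extMap f (ModuleCat.of R R) 0 ∘ₗ (dualEquivExtZero B : Dual R B →ₗ[R] _) :=
    LinearMap.ext fun φ => (extMap_dualEquivExtZero f φ).symm
  rw [← LinearMap.range_comp, this, LinearMap.range_comp, LinearEquiv.range, Submodule.map_top]

theorem nonempty_dual_quotient_equiv_ext_one {S : ShortComplex (ModuleCat.{u} R)}
    (hS : S.ShortExact) [Module.Projective R S.X₂] :
    Nonempty ((Dual R S.X₁ ⧸ LinearMap.range S.f.hom.dualMap) ≃ₗ[R]
      Ext S.X₃ (ModuleCat.of R R) 1) := by
  obtain ⟨e⟩ := nonempty_ext_quotient_equiv hS (ModuleCat.of R R) 0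
    (subsingleton_ext_of_projective _ _ _)
  exact ⟨(Submodule.Quotient.equiv _ _ (dualEquivExtZero S.X₁)
    (map_dualEquivExtZero_range_dualMap S.f)).trans e⟩

theorem subsingleton_ext_one_iff_surjective_dualMap {S : ShortComplex (ModuleCat.{u} R)}
    (hS : S.ShortExact) [Module.Projective R S.X₂] :
    Subsingleton (Ext S.X₃ (ModuleCat.of R R) 1) ↔ Function.Surjective S.f.hom.dualMap := by
  obtain ⟨e⟩ := nonempty_dual_quotient_equiv_ext_one hS
  rw [← e.toEquiv.subsingleton_congr, Submodule.Quotient.subsingleton_iff, LinearMap.range_eq_top]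

end Dual

section Separating

theorem separatingLeft_ext_of_projective (X Q : ModuleCat.{u} R) [Module.Finite R Q]
    [Module.Projective R Q] (n : ℕ) :
    (Ext.bilinearCompOfLinear R X Q (ModuleCat.of R R) n 0 n (add_zero n)).SeparatingLeft := by
  obtain ⟨m, p, s, -, -, hps⟩ := Module.Finite.exists_comp_eq_id_of_projective R Q
  let e := ModuleCat.biproductIsoPi fun _ : Fin m => ModuleCat.of R R
  let s' : Q ⟶ ⨁ fun _ : Fin m => ModuleCat.of R R := ModuleCat.ofHom s ≫ e.inv
  have hs' : s' ≫ e.hom ≫ ModuleCat.ofHom p = 𝟙 Q := by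
    ext q
    simpa [s'] using LinearMap.congr_fun hps q
  intro x hx
  have h0 : x.comp (Ext.mk₀ s') (add_zero n) = 0 := by
    apply (Ext.addEquivBiproduct X (biproduct.isBilimit _) n).injective
    rw [map_zero]
    ext i
    simp only [Ext.bilinearCompOfLinear_apply_apply] at hx
    simp [Ext.addEquivBiproduct, Ext.comp_assoc_of_second_deg_zero, hx]
  rw [← Ext.comp_mk₀_id x, ← hs', ← Ext.mk₀_comp_mk₀,
    ← Ext.comp_assoc_of_second_deg_zero, h0, Ext.zero_comp]

theorem separatingLeft_ext_of_shortExact {X Y : ModuleCat.{u} R}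
    {S : ShortComplex (ModuleCat.{u} R)} (hS : S.ShortExact) {m j n : ℕ} (hm : m + (j + 1) = n)
    (h₂ : Subsingleton (Ext X S.X₂ m))
    (h₁ : (Ext.bilinearCompOfLinear R X S.X₁ Y (m + 1) j n (by omega)).SeparatingLeft) :
    (Ext.bilinearCompOfLinear R X S.X₃ Y m (j + 1) n hm).SeparatingLeft := by
  intro g hg
  have hδ : g.comp hS.extClass rfl = 0 := h₁ _ fun e =>
    (Ext.comp_assoc g hS.extClass e rfl (add_comm 1 j) (by omega)).trans (hg _)
  obtain ⟨x, rfl⟩ := Ext.covariant_sequence_exact₃ _ hS g rfl hδ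
  rw [Subsingleton.elim x 0, Ext.zero_comp]

theorem extMap_ne_zero_of_separatingLeft {X K W Y : ModuleCat.{u} R} {n : ℕ}
    (h : (Ext.bilinearCompOfLinear R X W Y 0 n n (zero_add n)).SeparatingLeft) (κ : X ⟶ K)
    (f : K ⟶ W) (hκ : κ ≫ f ≠ 0) : extMap f Y n ≠ 0 := by
  intro h0
  refine hκ (Ext.mk₀_eq_zero_iff _ |>.1 (h _ fun e => ?_))
  have he : (Ext.mk₀ f).comp e (zero_add n) = 0 := LinearMap.congr_fun h0 e
  rw [Ext.bilinearCompOfLinear_apply_apply, ← Ext.mk₀_comp_mk₀_assoc, he, Ext.comp_zero]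

end Separating

end Ext

section ResidueSpace

variable {R : Type u} [CommRing R] [IsLocalRing R] {U V W : Type u} [AddCommGroup U] [Module R U]
  [AddCommGroup V] [Module R V] [AddCommGroup W] [Module R W]

theorem injective_of_equiv_residueField {V W : Type*} [AddCommGroup V] [Module R V]
    [AddCommGroup W] [Module R W] (e : ResidueField R ≃ₗ[R] V) {f : V →ₗ[R] W} (hf : f ≠ 0) :
    Function.Injective f :=
  have : IsSimpleModule R (ResidueField R) :=
    isSimpleModule_iff_isCoatom.2 (maximalIdeal.isMaximal R).out
  have : IsSimpleModule R V := .congr e.symm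
  LinearMap.injective_of_ne_zero hf

theorem isResidueSpace_of_module [Module (ResidueField R) V] [IsScalarTower R (ResidueField R) V] :
    IsResidueSpace R V := fun v r => by
  rw [← algebraMap_smul (ResidueField R) (r : R) v,
    show algebraMap R (ResidueField R) r = 0 from (residue_eq_zero_iff _).2 r.2, zero_smul]

theorem IsResidueSpace.of_surjective (hV : IsResidueSpace R V) {g : V →ₗ[R] W}
    (hg : Function.Surjective g) : IsResidueSpace R W := fun w r => by
  obtain ⟨v, rfl⟩ := hg w
  rw [← map_smul, hV, map_zero]

theorem IsResidueSpace.of_injective (hV : IsResidueSpace R V) {f : U →ₗ[R] V}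
    (hf : Function.Injective f) : IsResidueSpace R U := fun u r =>
  hf <| by rw [map_smul, hV, map_zero]

theorem IsResidueSpace.isScalarTower (hV : IsResidueSpace R V) :
    letI := hV.module
    IsScalarTower R (ResidueField R) V :=
  Module.IsTorsionBySet.isScalarTower hV

theorem IsResidueSpace.dim_eq_rank (hV : IsResidueSpace R V) [Module (ResidueField R) W]
    [IsScalarTower R (ResidueField R) W] (e : V ≃ₗ[R] W) :
    hV.dim = Module.rank (ResidueField R) W :=
  letI := hV.module
  haveI := hV.isScalarTower
  (e.extendScalarsOfSurjective residue_surjective).rank_eq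

theorem IsResidueSpace.dim_add_dim_of_exact (hU : IsResidueSpace R U) (hV : IsResidueSpace R V)
    (hW : IsResidueSpace R W) {f : U →ₗ[R] V} {g : V →ₗ[R] W} (hf : Function.Injective f)
    (hfg : Function.Exact f g) (hg : Function.Surjective g) : hW.dim + hU.dim = hV.dim := by
  let := hU.module
  have := hU.isScalarTower
  let := hV.module
  have := hV.isScalarTower
  let := hW.module
  have := hW.isScalarTower
  let f' := f.extendScalarsOfSurjective (S := ResidueField R) residue_surjective
  let g' := g.extendScalarsOfSurjective (S := ResidueField R) residue_surjective
  have hker : g'.ker = f'.range := SetLike.coe_injective (Set.ext hfg)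
  calc hW.dim + hU.dim = Module.rank (ResidueField R) W + Module.rank (ResidueField R) g'.ker := by
        rw [hker, ← (LinearEquiv.ofInjective f' hf).rank_eq]; rfl
    _ = hV.dim := (LinearMap.rank_eq_of_surjective (f := g') hg).symm

theorem IsResidueSpace.nonempty_equiv [Module.Finite R V] (hV : IsResidueSpace R V) :
    Nonempty (V ≃ₗ[R] (Fin (Cardinal.toNat hV.dim) → ResidueField R)) := by
  let := hV.module
  have := hV.isScalarTower
  have : Module.Finite (ResidueField R) V := .of_restrictScalars_finite R _ _
  exact ⟨(Module.finBasis (ResidueField R) V).equivFun.restrictScalars R⟩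

end ResidueSpace

section Depth

variable (R : Type u) [CommRing R] [IsNoetherianRing R] [IsLocalRing R]

theorem exists_isRegular_iff_subsingleton_ext (n : ℕ) :
    (∃ rs : List R, rs.length = n ∧ (∀ r ∈ rs, r ∈ maximalIdeal R) ∧
      RingTheory.Sequence.IsRegular R rs) ↔
    ∀ i < n, Subsingleton (Ext (ModuleCat.of R (ResidueField R)) (ModuleCat.of R R) i) := by
  have hlt : maximalIdeal R • (⊤ : Submodule R R) < ⊤ := by
    rw [smul_eq_mul, Ideal.mul_top, lt_top_iff_ne_top]
    exact Ideal.IsPrime.ne_top'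
  have hRees := (ModuleCat.exists_isRegular_tfae (maximalIdeal R) n (ModuleCat.of R R) hlt).out 1 3
  rw [← hRees]
  let e : ModuleCat.of R (Shrink.{u} (R ⧸ maximalIdeal R)) ≅ ModuleCat.of R (ResidueField R) :=
    (Shrink.linearEquiv R (R ⧸ maximalIdeal R)).toModuleIso
  exact forall₂_congr fun i _ => (extCongrLeft e _ i).toEquiv.subsingleton_congr

theorem nonempty_ext_residueField_equiv (i : ℕ) :
    Nonempty (Ext (ModuleCat.of R (ResidueField R)) (ModuleCat.of R R) i ≃ₗ[R]
      (Fin (bassNumber R i) → ResidueField R)) :=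
  have : Module.Finite R (ModuleCat.of R (ResidueField R)) :=
    inferInstanceAs (Module.Finite R (R ⧸ maximalIdeal R))
  have : Module.Finite R (ModuleCat.of R R) := inferInstanceAs (Module.Finite R R)
  (isResidueSpace_ext_residueField R (ModuleCat.of R R) i).nonempty_equiv

variable {R}

omit [IsNoetherianRing R] in
theorem nonempty_ext_equiv_pi_ext {K : ModuleCat.{u} R} {r : ℕ}
    (e : K ≃ₗ[R] (Fin r → ResidueField R)) (Y : ModuleCat.{u} R) (i : ℕ) :
    Nonempty (Ext K Y i ≃ₗ[R] (Fin r → Ext (ModuleCat.of R (ResidueField R)) Y i)) := by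
  obtain ⟨e'⟩ := nonempty_ext_pi_equiv (ModuleCat.of R (ResidueField R)) Y r i
  let e : K ≅ ModuleCat.of R (Fin r → ModuleCat.of R (ResidueField R)) := e.toModuleIso
  exact ⟨extCongrLeft e Y i ≪≫ₗ e'⟩

theorem nonempty_ext_equiv_of_equiv_pi {K : ModuleCat.{u} R} {r : ℕ}
    (e : K ≃ₗ[R] (Fin r → ResidueField R)) (i : ℕ) :
    Nonempty (Ext K (ModuleCat.of R R) i ≃ₗ[R] (Fin (r * bassNumber R i) → ResidueField R)) := by
  obtain ⟨e₁⟩ := nonempty_ext_equiv_pi_ext e (ModuleCat.of R R) i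
  obtain ⟨e₂⟩ := nonempty_ext_residueField_equiv R i
  exact ⟨e₁ ≪≫ₗ LinearEquiv.piCongrRight (fun _ => e₂) ≪≫ₗ
    (LinearEquiv.curry R (ResidueField R) _ _).symm ≪≫ₗ
    LinearEquiv.funCongrLeft R (ResidueField R) finProdFinEquiv.symm⟩

variable {t : ℕ} (ht : depth R = t)
include ht

theorem subsingleton_ext_of_lt_depth (i : ℕ) (hi : i < t) :
    Subsingleton (Ext (ModuleCat.of R (ResidueField R)) (ModuleCat.of R R) i) := by
  have hlt : (i : ℕ∞) < depth R := by rw [ht]; exact_mod_cast hi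
  obtain ⟨rs, hrs⟩ := lt_iSup_iff.1 hlt
  exact (exists_isRegular_iff_subsingleton_ext R _).1 ⟨rs.1, rfl, rs.2⟩ i (by exact_mod_cast hrs)

theorem nontrivial_ext_depth :
    Nontrivial (Ext (ModuleCat.of R (ResidueField R)) (ModuleCat.of R R) t) := by
  by_contra hne
  rw [not_nontrivial_iff_subsingleton] at hne
  obtain ⟨rs, hlen, hrs⟩ := (exists_isRegular_iff_subsingleton_ext R (t + 1)).2 fun i hi => by
    rcases Nat.lt_succ_iff_lt_or_eq.1 hi with hi | rfl
    · exact subsingleton_ext_of_lt_depth ht i hi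
    · exact hne
  have hle : (rs.length : ℕ∞) ≤ depth R :=
    le_iSup (fun rs : {rs : List R // (∀ r ∈ rs, r ∈ maximalIdeal R) ∧
      RingTheory.Sequence.IsRegular R rs} => (rs.1.length : ℕ∞)) ⟨rs, hrs⟩
  rw [hlen, ht] at hle
  exact (Nat.lt_succ_self t).not_ge (by exact_mod_cast hle)

omit [IsNoetherianRing R] in
theorem ringType_eq_bassNumber : ringType R = bassNumber R t := by
  rw [ringType, ht, ENat.toNat_natCast]

theorem nonempty_ext_residueField_equiv_ringType :
    Nonempty (Ext (ModuleCat.of R (ResidueField R)) (ModuleCat.of R R) t ≃ₗ[R]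
      (Fin (ringType R) → ResidueField R)) := by
  rw [ringType_eq_bassNumber ht]
  exact nonempty_ext_residueField_equiv R t

theorem ringType_pos : 0 < ringType R := by
  obtain ⟨e⟩ := nonempty_ext_residueField_equiv_ringType ht
  have := nontrivial_ext_depth ht
  refine Nat.pos_of_ne_zero fun h0 => ?_
  rw [h0] at e
  exact not_subsingleton _ e.toEquiv.subsingleton

end Depth

open Module

attribute [instance] ProjPresentation.finite₁ ProjPresentation.finite₀
  ProjPresentation.projective₁ ProjPresentation.projective₀

variable {R : Type u} [CommRing R]

section Quotient

variable {L M N : Type u} [AddCommGroup L] [Module R L] [AddCommGroup M] [Module R M]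
  [AddCommGroup N] [Module R N]

theorem shortExact_mkQ {f : M →ₗ[R] N} {P : Submodule R N} (hf : Function.Injective f)
    (hP : f.range = P) :
    (ModuleCat.shortComplexOfCompEqZero f P.mkQ
      (LinearMap.range_le_ker_iff.1 (by rw [hP, P.ker_mkQ]))).ShortExact :=
  ModuleCat.shortComplex_shortExact _ (LinearMap.exact_iff.2 (P.ker_mkQ.trans hP.symm)) hf
    P.mkQ_surjective

variable {α : L →ₗ[R] M} {δ : M →ₗ[R] N}

theorem exact_mapQ_liftQ (hαδ : Function.Exact α δ) {U : Submodule R L} {V : Submodule R M}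
    (hU : U ≤ V.comap α) (hV : V ≤ δ.rangeRestrict.ker) :
    Function.Exact (U.mapQ V α hU) (V.liftQ δ.rangeRestrict hV) := by
  intro y
  induction y using Submodule.Quotient.induction_on with | _ m
  constructor
  · intro hm
    obtain ⟨l, rfl⟩ := (hαδ m).1 (congrArg Subtype.val hm)
    exact ⟨U.mkQ l, rfl⟩
  · rintro ⟨x, hx⟩
    induction x using Submodule.Quotient.induction_on with | _ l
    rw [← hx]
    exact Subtype.ext (hαδ.apply_apply_eq_zero l)

theorem shortExact_mapQ_liftQ (hαδ : Function.Exact α δ) {U : Submodule R L} {V : Submodule R M}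
    (hU : V.comap α = U) (hV : V ≤ δ.rangeRestrict.ker) :
    (ModuleCat.shortComplexOfCompEqZero (U.mapQ V α hU.ge) (V.liftQ δ.rangeRestrict hV)
      (exact_mapQ_liftQ hαδ hU.ge hV).linearMap_comp_eq_zero).ShortExact :=
  ModuleCat.shortComplex_shortExact _ (exact_mapQ_liftQ hαδ hU.ge hV)
    (LinearMap.ker_eq_bot.1 (by
      change (U.mapQ V α hU.ge).ker = ⊥
      rw [Submodule.ker_mapQ, hU, Submodule.mkQ_map_self]))
    (LinearMap.range_eq_top.1 ((V.range_liftQ _ hV).trans δ.range_rangeRestrict))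

end Quotient

theorem range_dualMap_dualMap {M N : Type*} [AddCommGroup M] [Module R M] [AddCommGroup N]
    [Module R N] [IsReflexive R M] (f : M →ₗ[R] N) :
    LinearMap.range f.dualMap.dualMap = f.range.map (Dual.eval R N) := by
  rw [← LinearMap.range_comp, ← Dual.eval_naturality, ← evalEquiv_toLinearMap,
    LinearMap.range_comp, LinearEquiv.range, Submodule.map_top]

namespace ProjPresentation

variable {A : ModuleCat.{u} R} (π : ProjPresentation R A)

/-- The Auslander transpose computed from a presentation. -/
abbrev transpose : ModuleCat.{u} R :=
  ModuleCat.of R (Dual R π.P₁ ⧸ LinearMap.range π.d.dualMap)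

theorem exact_dualMap : Function.Exact π.aug.dualMap π.d.dualMap :=
  LinearMap.exact_lcomp_of_exact_of_surjective R π.exact π.surjective

theorem exact_rangeRestrict_dualMap : Function.Exact π.aug.dualMap π.d.dualMap.rangeRestrict :=
  fun ξ => Subtype.ext_iff.trans (π.exact_dualMap ξ)

/-- The image of `P₀* → P₁*`, a first syzygy of the transpose. -/
abbrev dualImage : ModuleCat.{u} R := ModuleCat.of R (LinearMap.range π.d.dualMap)

theorem nonempty_ext_dualImage_equiv (Y : ModuleCat.{u} R) {n : ℕ} (hn : 0 < n) :
    Nonempty (Ext π.dualImage Y n ≃ₗ[R] Ext π.transpose Y (n + 1)) :=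
  nonempty_ext_equiv_ext_succ_of_projective
    (shortExact_mkQ (Submodule.subtype_injective _) (Submodule.range_subtype _)) Y hn

/-- A linear form on `Im(P₀* → P₁*)` pulls back to evaluation at an element `p` of `P₀`, and `p`
is a relation because all forms on `A` kill its image. -/
theorem surjective_dualMap_subtype_dualImage (hA : Function.Injective (Dual.eval R A)) :
    Function.Surjective (LinearMap.range π.d.dualMap).subtype.dualMap := by
  intro φ
  obtain ⟨p, hp⟩ := (evalEquiv R π.P₀).surjective (φ ∘ₗ π.d.dualMap.rangeRestrict)
  have hφ (ξ : Dual R π.P₀) : ξ p = φ (π.d.dualMap.rangeRestrict ξ) := LinearMap.congr_fun hp ξ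
  have hp0 : π.aug p = 0 := (injective_iff_map_eq_zero _).1 hA _ <| LinearMap.ext fun ψ =>
    (hφ (π.aug.dualMap ψ)).trans <| by
      rw [π.exact_rangeRestrict_dualMap.apply_apply_eq_zero, map_zero]; rfl
  obtain ⟨q, rfl⟩ := (π.exact p).1 hp0
  refine ⟨Dual.eval R π.P₁ q, LinearMap.ext ?_⟩
  rintro ⟨_, ξ, rfl⟩
  exact hφ ξ

theorem subsingleton_ext_one_transpose (hA : Function.Injective (Dual.eval R A)) :
    Subsingleton (Ext π.transpose (ModuleCat.of R R) 1) :=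
  (subsingleton_ext_one_iff_surjective_dualMap
    (shortExact_mkQ (Submodule.subtype_injective _) (Submodule.range_subtype _))).2
    (π.surjective_dualMap_subtype_dualImage hA)

theorem range_extMap_dualMap_aug :
    (extMap (ModuleCat.ofHom π.aug.dualMap) (ModuleCat.of R R) 0).range =
      (Dual.eval R A).range.map
        (dualEquivExtZero (ModuleCat.of R (Dual R A)) : Dual R (Dual R A) →ₗ[R] _) := by
  rw [← map_dualEquivExtZero_range_dualMap]
  congr 1
  exact (range_dualMap_dualMap π.aug).trans (by
    rw [LinearMap.range_eq_top.2 π.surjective, Submodule.map_top])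

section SubsingletonDual

variable [Subsingleton (Dual R A)]

theorem injective_dualMap_d : Function.Injective π.d.dualMap := by
  rw [injective_iff_map_eq_zero]
  intro ξ hξ
  obtain ⟨ψ, rfl⟩ := (π.exact_dualMap ξ).1 hξ
  rw [Subsingleton.elim ψ 0, map_zero]

theorem nonempty_equiv_ext_one_transpose :
    Nonempty (A ≃ₗ[R] Ext π.transpose (ModuleCat.of R R) 1) := by
  obtain ⟨e⟩ := nonempty_dual_quotient_equiv_ext_one (shortExact_mkQ π.injective_dualMap_d rfl)
  exact ⟨(π.exact.linearEquivOfSurjective π.surjective).symm ≪≫ₗ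
    Submodule.Quotient.equiv _ _ (evalEquiv R π.P₀) (range_dualMap_dualMap π.d).symm ≪≫ₗ e⟩

end SubsingletonDual

section Splice

variable {S : ShortComplex (ModuleCat.{u} R)} (hS : S.ShortExact) [Module.Finite R S.X₂]
  [Module.Projective R S.X₂] (π : ProjPresentation R S.X₁)

/-- The presentation `P₀ → S.X₂ → S.X₃ → 0` spliced from `0 → S.X₁ → S.X₂ → S.X₃ → 0` and a
presentation `P₁ → P₀ → S.X₁ → 0`. -/
def splice : ProjPresentation R S.X₃ where
  P₁ := π.P₀
  P₀ := S.X₂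
  finite₁ := inferInstance
  finite₀ := inferInstance
  projective₁ := inferInstance
  projective₀ := inferInstance
  d := S.f.hom ∘ₗ π.aug
  aug := S.g.hom
  exact := LinearMap.exact_iff.2 <| by
    rw [LinearMap.range_comp, LinearMap.range_eq_top.2 π.surjective, Submodule.map_top]
    exact hS.exact.moduleCat_range_eq_ker.symm
  surjective := hS.moduleCat_surjective_g

theorem range_dualMap_d_splice :
    LinearMap.range (π.splice hS).d.dualMap =
      (LinearMap.range S.f.hom.dualMap).map π.aug.dualMap := by
  rw [← LinearMap.range_comp]
  rfl

theorem exists_shortExact_dualImage :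
    ∃ (f : ModuleCat.of R (Dual R S.X₁ ⧸ LinearMap.range S.f.hom.dualMap) ⟶
        (π.splice hS).transpose) (g : (π.splice hS).transpose ⟶ π.dualImage) (w : f ≫ g = 0),
      (ShortComplex.mk f g w).ShortExact := by
  have hV : LinearMap.range (π.splice hS).d.dualMap ≤ π.d.dualMap.rangeRestrict.ker := by
    rw [LinearMap.ker_rangeRestrict, π.exact_dualMap.linearMap_ker_eq, range_dualMap_d_splice]
    exact LinearMap.map_le_range
  have hU : (LinearMap.range (π.splice hS).d.dualMap).comap π.aug.dualMap =
      LinearMap.range S.f.hom.dualMap := by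
    rw [range_dualMap_d_splice, Submodule.comap_map_eq_of_injective
      (LinearMap.dualMap_injective_of_surjective π.surjective)]
  exact ⟨_, _, _, shortExact_mapQ_liftQ π.exact_dualMap hU hV⟩

theorem exists_shortExact_transpose (h : Subsingleton (Ext S.X₃ (ModuleCat.of R R) 1)) :
    ∃ (f : (π.splice hS).transpose ⟶ ModuleCat.of R (Dual R π.P₁))
      (g : ModuleCat.of R (Dual R π.P₁) ⟶ π.transpose) (w : f ≫ g = 0),
      (ShortComplex.mk f g w).ShortExact := by
  have hker : LinearMap.range (π.splice hS).d.dualMap = π.d.dualMap.ker := by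
    rw [range_dualMap_d_splice, π.exact_dualMap.linearMap_ker_eq, LinearMap.range_eq_top.2
      ((subsingleton_ext_one_iff_surjective_dualMap hS).1 h), Submodule.map_top]
  exact ⟨_, _, _, shortExact_mkQ
    (f := (LinearMap.range (π.splice hS).d.dualMap).liftQ π.d.dualMap hker.le)
    (LinearMap.ker_eq_bot.1 (Submodule.ker_liftQ_eq_bot _ _ _ hker.ge))
    (Submodule.range_liftQ _ _ _)⟩

end Splice

end ProjPresentation

theorem injective_dual_eval_of_shortExact {S : ShortComplex (ModuleCat.{u} R)} (hS : S.ShortExact)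
    [Module.Projective R S.X₂] : Function.Injective (Dual.eval R S.X₁) := by
  have h : Function.Injective (S.f.hom.dualMap.dualMap ∘ Dual.eval R S.X₁) := by
    rw [← LinearMap.coe_comp, Dual.eval_naturality]
    exact (eval_apply_injective R).comp hS.moduleCat_injective_f
  exact h.of_comp

section Syzygy

variable {M A : ModuleCat.{u} R}

theorem IsSyzygy.exists_shortExact (h : IsSyzygy R M A) :
    ∃ (Q : ModuleCat.{u} R) (_ : Module.Finite R Q) (_ : Module.Projective R Q) (f : A ⟶ Q)
      (g : Q ⟶ M) (w : f ≫ g = 0), (ShortComplex.mk f g w).ShortExact := by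
  obtain ⟨ρ, ⟨e⟩⟩ := h
  have hrange : (ρ.d.range.subtype ∘ₗ e.toLinearMap).range = ρ.d.range := by
    rw [LinearMap.range_comp, LinearEquiv.range, Submodule.map_top, Submodule.range_subtype]
  have hexact : Function.Exact (ρ.d.range.subtype ∘ₗ e.toLinearMap) ρ.aug :=
    LinearMap.exact_iff.2 (ρ.exact.linearMap_ker_eq.trans hrange.symm)
  exact ⟨ρ.P₀, inferInstance, inferInstance,
    ModuleCat.ofHom (ρ.d.range.subtype ∘ₗ e.toLinearMap), ModuleCat.ofHom ρ.aug,
    ModuleCat.hom_ext hexact.linearMap_comp_eq_zero,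
    ModuleCat.shortComplex_shortExact _ hexact (Subtype.val_injective.comp e.injective)
      ρ.surjective⟩

theorem IsNthSyzygy.nonempty_ext_equiv {j : ℕ} (h : IsNthSyzygy R j M A) (Y : ModuleCat.{u} R)
    {i : ℕ} (hi : 0 < i) : Nonempty (Ext A Y i ≃ₗ[R] Ext M Y (i + j)) := by
  induction j generalizing A i with
  | zero =>
    obtain ⟨e⟩ := h
    exact ⟨extCongrLeft e.toModuleIso Y i⟩
  | succ j ih =>
    obtain ⟨X, hX, hA⟩ := h
    obtain ⟨Q, _, _, f, g, w, hS⟩ := hA.exists_shortExact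
    obtain ⟨e₁⟩ := nonempty_ext_equiv_ext_succ_of_projective hS Y hi
    obtain ⟨e₂⟩ := ih hX i.succ_pos
    rw [← Nat.succ_add_eq_add_succ]
    exact ⟨e₁ ≪≫ₗ e₂⟩

end Syzygy

open Module

section ConcentratedExt

variable {R : Type u} [CommRing R]

/-- In positive degrees `Ext^i(T, R)` can be nonzero only for `i = d`, and a class of
`Ext^{t-d}(M, T)` is detected by its products with `Ext^d(T, R)` in `Ext^t(M, R)`.
Starting from a projective module with `d = 0`, cosyzygies of `T` have this property with `d`
raised step by step. -/
structure HasConcentratedExt (M T : ModuleCat.{u} R) (t d : ℕ) : Prop where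
  subsingleton_ext (i : ℕ) (hi : 0 < i) (hd : i ≠ d) : Subsingleton (Ext T (ModuleCat.of R R) i)
  separatingLeft (m : ℕ) (hm : m + d = t) :
    (Ext.bilinearCompOfLinear R M T (ModuleCat.of R R) m d t hm).SeparatingLeft

variable {M : ModuleCat.{u} R} {t : ℕ}

theorem HasConcentratedExt.of_projective (Q : ModuleCat.{u} R) [Module.Finite R Q]
    [Module.Projective R Q] : HasConcentratedExt M Q t 0 where
  subsingleton_ext i hi _ := by
    obtain ⟨i, rfl⟩ := Nat.exists_eq_succ_of_ne_zero hi.ne'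
    exact subsingleton_ext_of_projective Q _ i
  separatingLeft m hm := by
    obtain rfl : m = t := hm
    exact separatingLeft_ext_of_projective M Q m

theorem subsingleton_ext_of_projective_right (Q : ModuleCat.{u} R) [Module.Finite R Q]
    [Module.Projective R Q] {m : ℕ} (h : Subsingleton (Ext M (ModuleCat.of R R) m)) :
    Subsingleton (Ext M Q m) :=
  subsingleton_of_forall_eq 0 fun x =>
    separatingLeft_ext_of_projective M Q m x fun _ => h.allEq _ _

variable {A : ModuleCat.{u} R} {j : ℕ}

theorem IsNthSyzygy.subsingleton_dual (hA : IsNthSyzygy R 0 M A)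
    (h : Subsingleton (Ext M (ModuleCat.of R R) 0)) : Subsingleton (Dual R A) := by
  obtain ⟨e⟩ := hA
  exact (dualEquivExtZero A ≪≫ₗ extCongrLeft e.toModuleIso _ 0).toEquiv.subsingleton

variable (hM : ∀ i < t, Subsingleton (Ext M (ModuleCat.of R R) i))
include hM

theorem HasConcentratedExt.of_shortExact {S : ShortComplex (ModuleCat.{u} R)} (hS : S.ShortExact)
    [Module.Finite R S.X₂] [Module.Projective R S.X₂] {d : ℕ} (h : HasConcentratedExt M S.X₁ t d)
    (h₁ : 0 < d → Subsingleton (Ext S.X₃ (ModuleCat.of R R) 1)) :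
    HasConcentratedExt M S.X₃ t (d + 1) where
  subsingleton_ext i hi hd := by
    obtain ⟨i, rfl⟩ := Nat.exists_eq_succ_of_ne_zero hi.ne'
    obtain rfl | hi' := Nat.eq_zero_or_pos i
    · exact h₁ (by omega)
    · obtain ⟨e⟩ := nonempty_ext_equiv_ext_succ_of_projective hS (ModuleCat.of R R) hi'
      exact e.toEquiv.subsingleton_congr.1 (h.subsingleton_ext i hi' (by omega))
  separatingLeft m hm := separatingLeft_ext_of_shortExact hS hm
    (subsingleton_ext_of_projective_right _ (hM m (by omega))) (h.separatingLeft _ _)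

theorem IsNthSyzygy.subsingleton_ext_one (hA : IsNthSyzygy R j M A) (hj : j + 1 < t) :
    Subsingleton (Ext A (ModuleCat.of R R) 1) := by
  obtain ⟨e⟩ := hA.nonempty_ext_equiv (ModuleCat.of R R) one_pos
  exact e.toEquiv.subsingleton_congr.2 (hM _ (by omega))

theorem IsNthSyzygy.hasConcentratedExt_transpose (hA : IsNthSyzygy R j M A) (hj : j < t)
    (π : ProjPresentation R A) : HasConcentratedExt M π.transpose t (j + 1) := by
  induction j generalizing A with
  | zero =>
    have := hA.subsingleton_dual (hM 0 hj)
    exact .of_shortExact hM (shortExact_mkQ π.injective_dualMap_d rfl) (.of_projective _)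
      fun h => absurd h (lt_irrefl 0)
  | succ j ih =>
    obtain ⟨X, hX, hA⟩ := hA
    obtain ⟨Q, _, _, f, g, w, hS⟩ := hA.exists_shortExact
    obtain ⟨f', g', w', hS'⟩ := π.exists_shortExact_transpose hS (hX.subsingleton_ext_one hM hj)
    exact .of_shortExact hM hS' (ih hX (by omega) (π.splice hS)) fun _ =>
      π.subsingleton_ext_one_transpose (injective_dual_eval_of_shortExact hS)

theorem IsNthSyzygy.nonempty_equiv_ext_transpose (hA : IsNthSyzygy R j M A) (hj : j < t)
    (π : ProjPresentation R A) :
    Nonempty (M ≃ₗ[R] Ext π.transpose (ModuleCat.of R R) (j + 1)) := by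
  induction j generalizing A with
  | zero =>
    have := hA.subsingleton_dual (hM 0 hj)
    obtain ⟨e⟩ := hA
    obtain ⟨e'⟩ := π.nonempty_equiv_ext_one_transpose
    exact ⟨e.symm ≪≫ₗ e'⟩
  | succ j ih =>
    obtain ⟨X, hX, hA⟩ := hA
    obtain ⟨Q, _, _, f, g, w, hS⟩ := hA.exists_shortExact
    obtain ⟨f', g', w', hS'⟩ := π.exists_shortExact_transpose hS (hX.subsingleton_ext_one hM hj)
    obtain ⟨e⟩ := ih hX (by omega) (π.splice hS)
    obtain ⟨e'⟩ := nonempty_ext_equiv_ext_succ_of_projective hS' (ModuleCat.of R R) j.succ_pos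
    exact ⟨e ≪≫ₗ e'⟩

end ConcentratedExt

section TypeCover

variable {R : Type u} [CommRing R] [IsLocalRing R] {t : ℕ}

/-- A short exact sequence `0 → K → W → I → 0` from which `Ext(I, R)` can be computed: `K` is a
`k`-vector space of dimension the type of `R`, `Ext^i(W, R)` is concentrated in degrees `0` and
`t`, and the image of `Ext^t(W, R)` in `Ext^t(K, R)` is one-dimensional. -/
structure IsTypeCover (t : ℕ) (S : ShortComplex (ModuleCat.{u} R)) : Prop where
  shortExact : S.ShortExact
  nonempty_equiv_pi : Nonempty (S.X₁ ≃ₗ[R] (Fin (ringType R) → ResidueField R))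
  subsingleton_ext (i : ℕ) (hi : 0 < i) (hit : i ≠ t) :
    Subsingleton (Ext S.X₂ (ModuleCat.of R R) i)
  nonempty_equiv_range : Nonempty (ResidueField R ≃ₗ[R] (extMap S.f (ModuleCat.of R R) t).range)
  injective_extMap (h : 0 < t) : Function.Injective (extMap S.f (ModuleCat.of R R) t)

theorem exists_ne_zero_of_equiv_pi {K : Type*} [AddCommGroup K] [Module R K] {r : ℕ} (hr : 0 < r)
    (e : K ≃ₗ[R] (Fin r → ResidueField R)) : ∃ κ : ResidueField R →ₗ[R] K, κ ≠ 0 := by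
  refine ⟨e.symm.toLinearMap ∘ₗ LinearMap.pi fun _ => LinearMap.id, fun h => ?_⟩
  have hone : e.symm (1 : Fin r → ResidueField R) = 0 := LinearMap.congr_fun h 1
  exact one_ne_zero (congrFun ((map_eq_zero_iff e.symm e.symm.injective).1 hone) ⟨0, hr⟩)

variable [IsNoetherianRing R]

theorem nonempty_dual_equiv_pi (ht : depth R = (0 : ℕ)) {A : ModuleCat.{u} R}
    (e : A ≃ₗ[R] ResidueField R) :
    Nonempty (Dual R A ≃ₗ[R] (Fin (ringType R) → ResidueField R)) := by
  obtain ⟨e'⟩ := nonempty_ext_residueField_equiv_ringType ht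
  let i : A ≅ ModuleCat.of R (ResidueField R) := e.toModuleIso
  exact ⟨dualEquivExtZero A ≪≫ₗ extCongrLeft i _ 0 ≪≫ₗ e'⟩

theorem IsNthSyzygy.injective_dual_eval (ht : depth R = t) {A : ModuleCat.{u} R}
    (hA : IsNthSyzygy R t (ModuleCat.of R (ResidueField R)) A) :
    Function.Injective (Dual.eval R A) := by
  cases t with
  | zero =>
    obtain ⟨e⟩ := hA
    obtain ⟨e'⟩ := nonempty_dual_equiv_pi ht e
    have : NeZero (ringType R) := ⟨(ringType_pos ht).ne'⟩
    have : Nontrivial (Dual R A) := e'.toEquiv.nontrivial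
    obtain ⟨φ, hφ⟩ := exists_ne (0 : Dual R A)
    exact fun a b hab => injective_of_equiv_residueField e.symm hφ (LinearMap.congr_fun hab φ)
  | succ t =>
    obtain ⟨X, -, hA⟩ := hA
    obtain ⟨Q, _, _, f, g, w, hS⟩ := hA.exists_shortExact
    exact injective_dual_eval_of_shortExact hS

theorem isTypeCover_zero (ht : depth R = (0 : ℕ)) {A : ModuleCat.{u} R}
    (hA : IsNthSyzygy R 0 (ModuleCat.of R (ResidueField R)) A) (π : ProjPresentation R A) :
    IsTypeCover 0 (ShortComplex.mk (X₃ := π.dualImage) (ModuleCat.ofHom π.aug.dualMap)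
      (ModuleCat.ofHom π.d.dualMap.rangeRestrict)
      (ModuleCat.hom_ext π.exact_rangeRestrict_dualMap.linearMap_comp_eq_zero)) where
  shortExact := ModuleCat.shortComplex_shortExact _ π.exact_rangeRestrict_dualMap
    (LinearMap.dualMap_injective_of_surjective π.surjective)
    π.d.dualMap.surjective_rangeRestrict
  nonempty_equiv_pi := hA.elim (nonempty_dual_equiv_pi ht)
  subsingleton_ext i hi _ :=
    (HasConcentratedExt.of_projective (M := A) (t := 0)
      (ModuleCat.of R (Dual R π.P₀))).subsingleton_ext i hi hi.ne'
  nonempty_equiv_range := by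
    have hinj := hA.injective_dual_eval ht
    obtain ⟨e⟩ := hA
    exact ⟨e.symm ≪≫ₗ LinearEquiv.ofInjective _ hinj ≪≫ₗ
      (dualEquivExtZero (ModuleCat.of R (Dual R A))).submoduleMap _ ≪≫ₗ
      LinearEquiv.ofEq _ _ π.range_extMap_dualMap_aug.symm⟩
  injective_extMap h := absurd h (lt_irrefl 0)

theorem isTypeCover_succ (ht : depth R = (t + 1 : ℕ)) {S : ShortComplex (ModuleCat.{u} R)}
    (hS : S.ShortExact) [Module.Finite R S.X₂] [Module.Projective R S.X₂]
    (hX : IsNthSyzygy R t (ModuleCat.of R (ResidueField R)) S.X₃) (π : ProjPresentation R S.X₁)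
    {f : ModuleCat.of R (Dual R S.X₁ ⧸ LinearMap.range S.f.hom.dualMap) ⟶
        (π.splice hS).transpose} {g : (π.splice hS).transpose ⟶ π.dualImage} {w : f ≫ g = 0}
    (hC : (ShortComplex.mk f g w).ShortExact) :
    IsTypeCover (t + 1) (ShortComplex.mk f g w) := by
  have hk := subsingleton_ext_of_lt_depth ht
  have hW := hX.hasConcentratedExt_transpose hk t.lt_succ_self (π.splice hS)
  obtain ⟨eW⟩ := hX.nonempty_equiv_ext_transpose hk t.lt_succ_self (π.splice hS)
  obtain ⟨e₁⟩ := nonempty_dual_quotient_equiv_ext_one hS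
  obtain ⟨e₂⟩ := hX.nonempty_ext_equiv (ModuleCat.of R R) one_pos
  obtain ⟨e₃⟩ := nonempty_ext_residueField_equiv_ringType ht
  rw [add_comm] at e₂
  have eK := e₁ ≪≫ₗ e₂ ≪≫ₗ e₃
  obtain ⟨κ, hκ⟩ := exists_ne_zero_of_equiv_pi (ringType_pos ht) eK
  have := hC.mono_f
  have hf : extMap f (ModuleCat.of R R) (t + 1) ≠ 0 :=
    extMap_ne_zero_of_separatingLeft (hW.separatingLeft 0 (zero_add _)) (ModuleCat.ofHom κ) f
      fun h => hκ (congrArg ModuleCat.Hom.hom (Limits.zero_of_comp_mono f h))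
  have hinj : Function.Injective (extMap f (ModuleCat.of R R) (t + 1)) :=
    injective_of_equiv_residueField eW hf
  exact ⟨hC, ⟨eK⟩, hW.subsingleton_ext, ⟨eW ≪≫ₗ LinearEquiv.ofInjective _ hinj⟩, fun _ => hinj⟩

theorem IsNthSyzygy.exists_isTypeCover (ht : depth R = t) {A : ModuleCat.{u} R}
    (hA : IsNthSyzygy R t (ModuleCat.of R (ResidueField R)) A) (π : ProjPresentation R A) :
    ∃ (K W : ModuleCat.{u} R) (f : K ⟶ W) (g : W ⟶ π.dualImage) (w : f ≫ g = 0),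
      IsTypeCover t (ShortComplex.mk f g w) := by
  cases t with
  | zero => exact ⟨_, _, _, _, _, isTypeCover_zero ht hA π⟩
  | succ t =>
    obtain ⟨X, hX, hA⟩ := hA
    obtain ⟨Q, _, _, f, g, w, hS⟩ := hA.exists_shortExact
    obtain ⟨f', g', w', hC⟩ := π.exists_shortExact_dualImage hS
    exact ⟨_, _, f', g', w', isTypeCover_succ ht hS hX π hC⟩

namespace IsTypeCover

variable {S : ShortComplex (ModuleCat.{u} R)} (hS : IsTypeCover t S)
include hS

theorem subsingleton_ext_of_lt (ht : depth R = t) {i : ℕ} (hi : i < t) :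
    Subsingleton (Ext S.X₃ (ModuleCat.of R R) (i + 1)) := by
  obtain ⟨eK⟩ := hS.nonempty_equiv_pi
  obtain ⟨e⟩ := nonempty_ext_equiv_pi_ext eK (ModuleCat.of R R) i
  have := subsingleton_ext_of_lt_depth ht i hi
  refine subsingleton_ext_of_injective_extMap hS.shortExact _ e.toEquiv.subsingleton ?_
  obtain rfl | hit := eq_or_ne (i + 1) t
  · exact hS.injective_extMap i.succ_pos
  · have := hS.subsingleton_ext (i + 1) i.succ_pos hit
    exact Function.injective_of_subsingleton _

theorem nonempty_ext_equiv {i : ℕ} (hi : t < i) :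
    Nonempty (Ext S.X₃ (ModuleCat.of R R) (i + 1) ≃ₗ[R]
      (Fin (ringType R * bassNumber R i) → ResidueField R)) := by
  obtain ⟨eK⟩ := hS.nonempty_equiv_pi
  obtain ⟨e⟩ := nonempty_ext_equiv_of_equiv_pi eK i
  obtain ⟨δ⟩ := nonempty_ext_equiv_ext_succ hS.shortExact (ModuleCat.of R R) i
    (hS.subsingleton_ext i (by omega) (by omega)) (hS.subsingleton_ext _ i.succ_pos (by omega))
  exact ⟨δ.symm ≪≫ₗ e⟩

theorem exists_dim_add_one_eq (ht : depth R = t) {E : Type u} [AddCommGroup E] [Module R E]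
    (e : Ext S.X₃ (ModuleCat.of R R) (t + 1) ≃ₗ[R] E) :
    ∃ h : IsResidueSpace R E, h.dim + 1 = ((ringType R ^ 2 : ℕ) : Cardinal.{u}) := by
  obtain ⟨eK⟩ := hS.nonempty_equiv_pi
  obtain ⟨eV⟩ := nonempty_ext_equiv_of_equiv_pi eK t
  obtain ⟨eU⟩ := hS.nonempty_equiv_range
  obtain ⟨δ⟩ := nonempty_ext_quotient_equiv hS.shortExact (ModuleCat.of R R) t
    (hS.subsingleton_ext _ t.succ_pos (by omega))
  replace δ := δ ≪≫ₗ e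
  set U := (extMap S.f (ModuleCat.of R R) t).range
  have hV : IsResidueSpace R (Ext S.X₁ (ModuleCat.of R R) t) :=
    isResidueSpace_of_module.of_injective eV.injective
  have hU : IsResidueSpace R U := hV.of_injective U.subtype_injective
  have hg : Function.Surjective (δ.toLinearMap ∘ₗ U.mkQ) := δ.surjective.comp U.mkQ_surjective
  have hexact : Function.Exact U.subtype (δ.toLinearMap ∘ₗ U.mkQ) :=
    LinearMap.exact_iff.2 (by rw [δ.ker_comp, U.ker_mkQ, U.range_subtype])
  have hdim := hU.dim_add_dim_of_exact hV (hV.of_surjective hg) U.subtype_injective hexact hg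
  refine ⟨hV.of_surjective hg, ?_⟩
  rwa [hU.dim_eq_rank eU.symm, rank_self, hV.dim_eq_rank eV, rank_fin_fun,
    ← ringType_eq_bassNumber ht, ← sq] at hdim

end IsTypeCover

section Transpose

variable {A T : ModuleCat.{u} R} (ht : depth R = t)
  (hA : IsNthSyzygy R t (ModuleCat.of R (ResidueField R)) A) (hT : IsTranspose R A T)
include ht hA hT

theorem IsNthSyzygy.subsingleton_ext_one_transpose : Subsingleton (Ext T (ModuleCat.of R R) 1) := by
  obtain ⟨π, ⟨e⟩⟩ := hT
  exact (extCongrLeft e.toModuleIso _ 1).toEquiv.subsingleton_congr.2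
    (π.subsingleton_ext_one_transpose (hA.injective_dual_eval ht))

theorem IsNthSyzygy.exists_isTypeCover_transpose :
    ∃ S : ShortComplex (ModuleCat.{u} R), IsTypeCover t S ∧
      ∀ i, Nonempty (Ext S.X₃ (ModuleCat.of R R) (i + 1) ≃ₗ[R]
        Ext T (ModuleCat.of R R) (i + 2)) := by
  obtain ⟨π, ⟨e⟩⟩ := hT
  obtain ⟨K, W, f, g, w, hC⟩ := hA.exists_isTypeCover ht π
  refine ⟨_, hC, fun i => ?_⟩
  obtain ⟨e'⟩ := π.nonempty_ext_dualImage_equiv (ModuleCat.of R R) i.succ_pos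
  exact ⟨e' ≪≫ₗ extCongrLeft e.toModuleIso.symm _ _⟩

theorem IsNthSyzygy.subsingleton_ext_transpose (i : ℕ) (hi : 1 ≤ i) (hit : i ≤ t + 1) :
    Subsingleton (Ext T (ModuleCat.of R R) i) := by
  obtain rfl | hi := hi.eq_or_lt
  · exact hA.subsingleton_ext_one_transpose ht hT
  obtain ⟨i, rfl⟩ := Nat.exists_eq_add_of_le' (show 2 ≤ i from hi)
  obtain ⟨S, hS, e⟩ := hA.exists_isTypeCover_transpose ht hT
  exact (e i).elim fun e =>
    e.toEquiv.subsingleton_congr.1 (hS.subsingleton_ext_of_lt ht (by omega))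

theorem IsNthSyzygy.exists_dim_ext_transpose_add_one_eq :
    ∃ h : IsResidueSpace R (Ext T (ModuleCat.of R R) (t + 2)),
      h.dim + 1 = ((ringType R ^ 2 : ℕ) : Cardinal.{u}) := by
  obtain ⟨S, hS, e⟩ := hA.exists_isTypeCover_transpose ht hT
  obtain ⟨e⟩ := e t
  exact hS.exists_dim_add_one_eq ht e

theorem IsNthSyzygy.nonempty_ext_transpose_equiv {i : ℕ} (hi : t + 3 ≤ i) :
    Nonempty (Ext T (ModuleCat.of R R) i ≃ₗ[R]
      (Fin (ringType R * bassNumber R (i - 2)) → ResidueField R)) := by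
  obtain ⟨i, rfl⟩ := Nat.exists_eq_add_of_le' (show 2 ≤ i by omega)
  obtain ⟨S, hS, e⟩ := hA.exists_isTypeCover_transpose ht hT
  obtain ⟨e⟩ := e i
  obtain ⟨e'⟩ := hS.nonempty_ext_equiv (i := i) (by omega)
  exact ⟨e.symm ≪≫ₗ e'⟩

end Transpose

end TypeCover

end LocalSyzygy

theorem corollary3p6 {R : Type u} [CommRing R] [IsNoetherianRing R] [IsLocalRing R]
    (t : ℕ) (ht : LocalSyzygy.depth R = t)
    (S T : ModuleCat.{u} R)
    (hS : LocalSyzygy.IsNthSyzygy R t (ModuleCat.of R (ResidueField R)) S)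
    (hT : LocalSyzygy.IsTranspose R S T) :
    ∃ h : ∀ i : ℕ, 0 < i → LocalSyzygy.IsResidueSpace R (Ext T (ModuleCat.of R R) i),
      (∀ i : ℕ, 1 ≤ i → i ≤ t + 1 → Subsingleton (Ext T (ModuleCat.of R R) i)) ∧
      -- addition of one on the left instead of subtraction on the right
      (h (t + 2) (by omega)).dim + 1 = ((LocalSyzygy.ringType R ^ 2 : ℕ) : Cardinal.{u}) ∧
      (∀ (i : ℕ) (hi : t + 3 ≤ i),
        (h i (by omega)).dim =
          ((LocalSyzygy.ringType R * LocalSyzygy.bassNumber R (i - 2) : ℕ) : Cardinal.{u})) := by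
  open LocalSyzygy in
  have hlow := hS.subsingleton_ext_transpose ht hT
  obtain ⟨hmid, hdim⟩ := hS.exists_dim_ext_transpose_add_one_eq ht hT
  have hhigh (i : ℕ) (hi : t + 3 ≤ i) := hS.nonempty_ext_transpose_equiv ht hT hi
  refine ⟨fun i hi => ?_, hlow, hdim, fun i hi => ?_⟩
  · obtain h | rfl | h := lt_trichotomy i (t + 2)
    · have := hlow i hi (by omega)
      exact fun x r => Subsingleton.elim _ _
    · exact hmid
    · obtain ⟨e⟩ := hhigh i h
      exact isResidueSpace_of_module.of_injective e.injective
  · obtain ⟨e⟩ := hhigh i hi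
    rw [IsResidueSpace.dim_eq_rank _ e, rank_fin_fun]
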